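/- **Theorem 3.1** (Extremum principle). Let $n,d\in\mathbb{N}$ and let $X$ be an $n\times n$ real symmetric random matrix with entries $$ X_{ij}=b_{ij}\,\xi_{ij}\quad (i\neq j),\qquad X_{ii}=\sqrt{2}\,b_{ii}\,\xi_{ii}, $$ where $b_{ij}=b_{ji}\ge 0$ are arbitrary nonnegative scalars, and $\xi_{ij}=\xi_{ji}$ are, for $i\ge j$, independent symmetrically distributed real random variables (that is, $\xi_{ij}$ and $-\xi_{ij}$ have the same law) such that $\mathbf{E}[\xi_{ij}^{2p}]\le \mathbf{E}[g^{2p}]$ for all $p\in\mathbb{N}$, where $g\sim N(0,1)$. Define $$ \sigma^2:=\max_{i\le n}\sum_{j\le n} b_{ij}^2,\qquad \sigma_*^2:=\max_{i,j\le n} b_{ij}^2 . $$ Assume that $\sigma_*^2=1$ and $\sigma^2\le d$. Let $Y$ be the $d\times d$ real symmetric random matrix whose entries $Y_{ij}=Y_{ji}$ are independent for $i\ge j$ with $Y_{ij}\sim N(0,1)$ for $i>j$ and $Y_{ii}\sim N(0,2)$. Then, for all $p\in\mathbb{N}$, both expectations below are finite and $$ \mathbf{E}[\operatorname{tr} X^{2p}]\le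 \mathbf{E}[\operatorname{tr} Y^{2p}], $$ where $\operatorname{tr} M:=\frac1k\operatorname{Tr} M$ denotes the normalized trace of a $k\times k$ matrix $M$. -/

import Mathlib

open MeasureTheory ProbabilityTheory

/-- The index set of the lower triangle (diagonal included) of an `n × n` matrix:
the pairs `(i, j)` with `i ≥ j`. -/
abbrev LowerIdx (n : ℕ) : Type := {q : Fin n × Fin n // q.2 ≤ q.1}

/-- The normalized trace `tr M = (1/n) Tr M` of an `n × n` real matrix. -/
noncomputable def normTrace {n : ℕ} (M : Matrix (Fin n) (Fin n) ℝ) : ℝ :=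
  (1 / (n : ℝ)) * M.trace

/-- `σ² = max_i ∑_j b_ij²`. (The supremum is over a finite set, hence a maximum when `n ≥ 1`;
for `n = 0` it is `0`.) -/
noncomputable def sigmaSq {n : ℕ} (b : Fin n → Fin n → ℝ) : ℝ :=
  ⨆ i : Fin n, ∑ j : Fin n, b i j ^ 2

/-- `σ_*² = max_{i,j} b_ij²`. (Again a maximum when `n ≥ 1`, and `0` for `n = 0`.) -/
noncomputable def sigmaStarSq {n : ℕ} (b : Fin n → Fin n → ℝ) : ℝ :=
  ⨆ q : Fin n × Fin n, b q.1 q.2 ^ 2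

/-- The nonhomogeneous real symmetric random matrix model: `X_ij = b_ij ξ_ij` for `i ≠ j` and
`X_ii = √2 b_ii ξ_ii`, where `b_ij = b_ji ≥ 0` and `ξ_ij = ξ_ji` are, for `i ≥ j`, independent
symmetrically distributed real random variables whose even moments are finite and at most those
of a standard Gaussian variable. -/
structure IsSymmModel {Ω : Type*} [MeasurableSpace Ω] (μ : Measure Ω) {n : ℕ}
    (b : Fin n → Fin n → ℝ) (ξ : Fin n → Fin n → Ω → ℝ)
    (X : Ω → Matrix (Fin n) (Fin n) ℝ) : Prop where
  b_nonneg : ∀ i j, 0 ≤ b i j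
  b_symm : ∀ i j, b i j = b j i
  xi_symm : ∀ i j, ξ i j = ξ j i
  xi_aemeasurable : ∀ i j, AEMeasurable (ξ i j) μ
  xi_indep : iIndepFun (fun q : LowerIdx n => ξ q.1.1 q.1.2) μ
  /-- `ξ_ij` and `-ξ_ij` have the same law. -/
  xi_symmDistrib : ∀ i j, IdentDistrib (ξ i j) (fun ω => -ξ i j ω) μ μ
  xi_integrable : ∀ i j, ∀ p : ℕ, Integrable (fun ω => ξ i j ω ^ (2 * p)) μ
  xi_moment_le : ∀ i j, ∀ p : ℕ,
    ∫ ω, ξ i j ω ^ (2 * p) ∂μ ≤ ∫ x, x ^ (2 * p) ∂(gaussianReal 0 1)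
  offDiag : ∀ i j, i ≠ j → ∀ ω, X ω i j = b i j * ξ i j ω
  diag : ∀ i, ∀ ω, X ω i i = √2 * b i i * ξ i i ω

/-- `Y` is a `d × d` GOE matrix: a real symmetric random matrix whose entries `Y_ij`, `i ≥ j`, are
independent with `Y_ij ∼ N(0,1)` for `i > j` and `Y_ii ∼ N(0,2)`. (The second argument of
`gaussianReal` is the variance.) -/
structure IsGOE {Ω : Type*} [MeasurableSpace Ω] (μ : Measure Ω) {d : ℕ}
    (Y : Ω → Matrix (Fin d) (Fin d) ℝ) : Prop where
  symm : ∀ ω, (Y ω).IsSymm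
  indep : iIndepFun (fun (q : LowerIdx d) ω => Y ω q.1.1 q.1.2) μ
  offDiag_law : ∀ i j, j < i → HasLaw (fun ω => Y ω i j) (gaussianReal 0 1) μ
  diag_law : ∀ i, HasLaw (fun ω => Y ω i i) (gaussianReal 0 2) μ

/-! Expand the expected trace over closed walks. By independence each walk contributes a product of
moments; odd moments vanish by symmetry and even ones are at most Gaussian, so `X` may be replaced
by a Gaussian matrix with the same variance profile (`IsSymmModel.integral_trace_pow_le`). Wick's
formula then gives a sum over pairings of the steps, each pair being matched with equal or opposite
orientation (`pairingSum_eq_sum`). The same oriented pairings occur for `X` and for `Y`, so it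
suffices to compare them one at a time. A fixed pairing forces identifications between the positions
of the walk. Steps leading to a position not identified with an earlier one lie in distinct pairs;
since `b i j ^ 2 ≤ 1`, all other pairs can be discarded (`prod_pairs_le_gluedWeight`). Summing over
positions, last first, each new position costs a row sum, at most `d`, and the starting point costs
`n` (`sum_gluedWeight_le`). For `Y` all weights are 1 and the row sums are exactly `d`, so the same
count is attained with `d` in place of `n` (`sum_gluedWeight_eq`). Normalizing the traces removes
the factors `n` and `d`. -/

/-! ### Gaussian moments. -/

/-- The `k`-th moment of a standard Gaussian variable. -/
noncomputable def gaussianMoment (k : ℕ) : ℝ := ∫ x, x ^ k ∂(gaussianReal 0 1)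

lemma integrable_pow_gaussianReal (k : ℕ) :
    Integrable (fun x : ℝ => x ^ k) (gaussianReal 0 1) := by
  have h := (memLp_id_gaussianReal (μ := 0) (v := 1) (k : NNReal)).integrable_norm_pow'
  refine (integrable_norm_iff (by fun_prop)).1 ?_
  simpa using h

lemma integrable_pow_mul_gaussianPDFReal (k : ℕ) :
    Integrable (fun x : ℝ => x ^ k * gaussianPDFReal 0 1 x) := by
  have h := integrable_pow_gaussianReal k
  rw [gaussianReal_of_var_ne_zero _ one_ne_zero, integrable_withDensity_iff_integrable_smul'
    (measurable_gaussianPDF _ _) (ae_of_all _ fun _ => gaussianPDF_lt_top)] at h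
  simpa [mul_comm] using h

lemma gaussianMoment_eq (k : ℕ) :
    gaussianMoment k = ∫ x, x ^ k * gaussianPDFReal 0 1 x := by
  rw [gaussianMoment, integral_gaussianReal_eq_integral_smul one_ne_zero]
  simp [mul_comm]

lemma hasDerivAt_gaussianPDFReal (x : ℝ) :
    HasDerivAt (gaussianPDFReal 0 1) (-x * gaussianPDFReal 0 1 x) x := by
  have h1 : HasDerivAt (fun y : ℝ => -(y - 0) ^ 2 / (2 * ((1 : NNReal) : ℝ))) (-x) x := by
    have := ((((hasDerivAt_id x).sub_const 0).pow 2).neg).div_const (2 * ((1 : NNReal) : ℝ))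
    exact this.congr_deriv (by simp; ring)
  have h2 := (h1.exp).const_mul ((√(2 * Real.pi * ((1 : NNReal) : ℝ)))⁻¹)
  rw [gaussianPDFReal_def]
  exact h2.congr_deriv (by ring)

lemma gaussianMoment_zero : gaussianMoment 0 = 1 := by simp [gaussianMoment]

lemma gaussianMoment_one : gaussianMoment 1 = 0 := by
  simp [gaussianMoment, integral_id_gaussianReal]

/-- Gaussian integration by parts. -/
lemma gaussianMoment_add_two (k : ℕ) :
    gaussianMoment (k + 2) = (k + 1) * gaussianMoment k := by
  have h := integral_eq_zero_of_hasDerivAt_of_integrable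
    (f := fun x : ℝ => x ^ (k + 1) * gaussianPDFReal 0 1 x)
    (f' := fun x : ℝ => (k + 1) * (x ^ k * gaussianPDFReal 0 1 x)
      - x ^ (k + 2) * gaussianPDFReal 0 1 x)
    (fun x => by
      refine ((hasDerivAt_pow (k + 1) x).mul (hasDerivAt_gaussianPDFReal x)).congr_deriv ?_
      rw [Nat.add_sub_cancel]
      push_cast
      ring)
    (((integrable_pow_mul_gaussianPDFReal k).const_mul _).sub
      (integrable_pow_mul_gaussianPDFReal (k + 2)))
    (integrable_pow_mul_gaussianPDFReal (k + 1))
  rw [integral_sub ((integrable_pow_mul_gaussianPDFReal k).const_mul _)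
    (integrable_pow_mul_gaussianPDFReal (k + 2)), integral_const_mul, ← gaussianMoment_eq,
    ← gaussianMoment_eq] at h
  linarith

lemma gaussianMoment_nonneg (k : ℕ) : 0 ≤ gaussianMoment k := by
  induction k using Nat.twoStepInduction with
  | zero => simp [gaussianMoment_zero]
  | one => simp [gaussianMoment_one]
  | more k h _ => rw [gaussianMoment_add_two]; positivity

/-! ### Traces of powers as sums over closed walks, and their expectations. -/

lemma sum_fin_succ_eq_sum_snoc {ι : Type*} [Fintype ι] {m : ℕ} (f : (Fin (m + 1) → ι) → ℝ) :
    ∑ u, f u = ∑ u : Fin m → ι, ∑ x, f (Fin.snoc u x) := by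
  rw [← (Fin.snocEquiv (fun _ : Fin (m + 1) => ι)).sum_comp, Fintype.sum_prod_type_right]
  rfl

/-- Powers of a matrix as sums over walks. -/
lemma matrix_pow_apply_eq_sum_walks {ι : Type*} [Fintype ι] [DecidableEq ι]
    (M : Matrix ι ι ℝ) (m : ℕ) (i j : ι) :
    (M ^ m) i j = ∑ u : Fin (m + 1) → ι, if u 0 = i ∧ u (Fin.last m) = j then
      ∏ k : Fin m, M (u k.castSucc) (u k.succ) else 0 := by
  induction m generalizing j with
  | zero =>
    rw [← (Equiv.funUnique (Fin 1) ι).symm.sum_comp]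
    simp only [pow_zero, Matrix.one_apply, Finset.univ_eq_empty, Finset.prod_empty]
    rw [Finset.sum_eq_single i]
    · simp [Equiv.funUnique]
    · intro b _ hb
      simp [Equiv.funUnique, hb]
    · simp
  | succ m ih =>
    rw [pow_succ, Matrix.mul_apply, sum_fin_succ_eq_sum_snoc]
    simp only [ih, Finset.sum_mul]
    rw [Finset.sum_comm]
    refine Finset.sum_congr rfl fun u _ => ?_
    have h0 : ∀ x, (Fin.snoc u x : Fin (m + 2) → ι) 0 = u 0 := fun x =>
      Fin.snoc_castSucc (α := fun _ => ι) x u 0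
    simp only [h0, Fin.snoc_last, Fin.prod_univ_castSucc, Fin.succ_last, Fin.snoc_castSucc,
      Fin.succ_castSucc]
    by_cases h : u 0 = i
    · simp [h, ite_mul]
    · simp [h]

lemma trace_pow_eq_sum_closed_walks {ι : Type*} [Fintype ι] [DecidableEq ι]
    (M : Matrix ι ι ℝ) (m : ℕ) :
    (M ^ m).trace = ∑ u : Fin (m + 1) → ι, if u 0 = u (Fin.last m) then
      ∏ k : Fin m, M (u k.castSucc) (u k.succ) else 0 := by
  simp only [Matrix.trace, Matrix.diag, matrix_pow_apply_eq_sum_walks]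
  rw [Finset.sum_comm]
  refine Finset.sum_congr rfl fun u _ => ?_
  by_cases h : u 0 = u (Fin.last m)
  · simp only [h, and_self, if_true]
    simp
  · rw [if_neg h]
    refine Finset.sum_eq_zero fun i _ => if_neg ?_
    rintro ⟨h1, h2⟩
    exact h (h1.trans h2.symm)

/-- The position in the lower triangle holding the entry `(i, j)` of a symmetric matrix. -/
def lowerIdx {n : ℕ} (i j : Fin n) : LowerIdx n := ⟨(max i j, min i j), min_le_max⟩

lemma lowerIdx_eq_iff {n : ℕ} {i j k l : Fin n} :
    lowerIdx i j = lowerIdx k l ↔ (i = k ∧ j = l) ∨ (i = l ∧ j = k) := by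
  simp only [lowerIdx, Subtype.mk.injEq, Prod.mk.injEq]
  rcases le_total i j with h | h <;> rcases le_total k l with h' | h' <;>
    simp only [max_eq_left, max_eq_right, min_eq_left, min_eq_right, h, h'] <;> omega

lemma memLp_of_integrable_pow {Ω : Type*} [MeasurableSpace Ω] {μ : Measure Ω}
    [IsProbabilityMeasure μ] {f : Ω → ℝ} (hf : AEMeasurable f μ)
    (h : ∀ p : ℕ, Integrable (fun ω => f ω ^ (2 * p)) μ) (m : ℕ) : MemLp f m μ := by
  rcases Nat.eq_zero_or_pos m with rfl | hm
  · simpa using hf.aestronglyMeasurable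
  · have h2 : MemLp f ((2 * m : ℕ) : ENNReal) μ := by
      rw [← integrable_norm_rpow_iff hf.aestronglyMeasurable (by positivity)
        (ENNReal.natCast_ne_top _)]
      refine (h m).congr (ae_of_all _ fun ω => ?_)
      simp only [ENNReal.toReal_natCast, Real.rpow_natCast, Real.norm_eq_abs]
      rw [pow_mul, pow_mul, sq_abs]
    exact h2.mono_exponent (by exact_mod_cast (by omega : m ≤ 2 * m))

/-- Hölder's inequality with `m` exponents all equal to `m`. -/
lemma integrable_prod_of_memLp {Ω : Type*} [MeasurableSpace Ω] {μ : Measure Ω}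
    [IsProbabilityMeasure μ] {m : ℕ} {f : Fin m → Ω → ℝ} (h : ∀ k, MemLp (f k) m μ) :
    Integrable (fun ω => ∏ k, f k ω) μ := by
  rcases Nat.eq_zero_or_pos m with rfl | hm
  · simp
  · have := MemLp.prod' (s := Finset.univ) (f := f) (p := fun _ => (m : ENNReal))
      (fun i _ => h i)
    rw [← memLp_one_iff_integrable]
    convert this using 1
    have hm0 : (m : ENNReal) ≠ 0 := by exact_mod_cast hm.ne'
    simp [ENNReal.mul_inv_cancel hm0]

section expectation

variable {Ω : Type*} [MeasurableSpace Ω] {μ : Measure Ω} [IsProbabilityMeasure μ] {n : ℕ}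
  {c : Fin n → Fin n → ℝ} {Z : LowerIdx n → Ω → ℝ} {X : Ω → Matrix (Fin n) (Fin n) ℝ}

lemma integrable_walk_product (hZm : ∀ q, AEMeasurable (Z q) μ)
    (hZi : ∀ q, ∀ p : ℕ, Integrable (fun ω => Z q ω ^ (2 * p)) μ) {m : ℕ}
    (u : Fin (m + 1) → Fin n) (hX : ∀ ω i j, X ω i j = c i j * Z (lowerIdx i j) ω) :
    Integrable (fun ω => ∏ k : Fin m, X ω (u k.castSucc) (u k.succ)) μ := by
  simp only [hX, Finset.prod_mul_distrib]
  exact (integrable_prod_of_memLp fun k => memLp_of_integrable_pow (hZm _) (hZi _) m).const_mul _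

lemma integrable_trace_pow (hZm : ∀ q, AEMeasurable (Z q) μ)
    (hZi : ∀ q, ∀ p : ℕ, Integrable (fun ω => Z q ω ^ (2 * p)) μ)
    (hX : ∀ ω i j, X ω i j = c i j * Z (lowerIdx i j) ω) (m : ℕ) :
    Integrable (fun ω => (X ω ^ m).trace) μ := by
  simp only [trace_pow_eq_sum_closed_walks]
  refine integrable_finsetSum _ fun u _ => ?_
  split_ifs
  · exact integrable_walk_product hZm hZi u hX
  · simp

/-- The expected trace of a power as a sum over closed walks, each of which contributes a product
of moments of the independent entries. -/
lemma integral_trace_pow (hZm : ∀ q, AEMeasurable (Z q) μ)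
    (hZi : ∀ q, ∀ p : ℕ, Integrable (fun ω => Z q ω ^ (2 * p)) μ) (hZ : iIndepFun Z μ)
    (hX : ∀ ω i j, X ω i j = c i j * Z (lowerIdx i j) ω) (m : ℕ) :
    ∫ ω, (X ω ^ m).trace ∂μ = ∑ u : Fin (m + 1) → Fin n, if u 0 = u (Fin.last m) then
      (∏ k : Fin m, c (u k.castSucc) (u k.succ)) *
        ∏ q, ∫ ω, Z q ω ^ (Finset.univ.filter
          fun k : Fin m => lowerIdx (u k.castSucc) (u k.succ) = q).card ∂μ else 0 := by
  simp only [trace_pow_eq_sum_closed_walks]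
  rw [integral_finsetSum]
  · refine Finset.sum_congr rfl fun u _ => ?_
    split_ifs
    · simp only [hX, Finset.prod_mul_distrib]
      rw [integral_const_mul]
      congr 1
      -- Independence applies once the steps are grouped by the matrix entry they use.
      rw [← iIndepFun.integral_fun_prod_comp (f := fun q x => x ^ (Finset.univ.filter
          fun k : Fin m => lowerIdx (u k.castSucc) (u k.succ) = q).card) hZ hZm
          (fun q => by fun_prop)]
      refine integral_congr_ae (ae_of_all _ fun ω => ?_)
      simp only
      rw [← Finset.prod_fiberwise (s := Finset.univ)
        (g := fun k : Fin m => lowerIdx (u k.castSucc) (u k.succ))]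
      refine Finset.prod_congr rfl fun q _ => ?_
      rw [← Finset.prod_const]
      refine Finset.prod_congr rfl fun k hk => ?_
      rw [(Finset.mem_filter.1 hk).2]
    · simp
  · intro u _
    split_ifs
    · exact integrable_walk_product hZm hZi u hX
    · simp

end expectation

/-! ### Wick's recursion. -/

/-- Wick's recursion for a product of independent standard Gaussian variables: the factor at the
position `a` is paired with each of the other positions carrying the same variable. -/
lemma prod_gaussianMoment_eq_sum {κ Q : Type*} [DecidableEq κ] [Fintype Q] [DecidableEq Q]
    (e : κ → Q) (A : Finset κ) {a : κ} (ha : a ∈ A) :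
    ∏ q, gaussianMoment (A.filter fun k => e k = q).card =
      ∑ l ∈ A.erase a, if e l = e a then
        ∏ q, gaussianMoment (((A.erase a).erase l).filter fun k => e k = q).card else 0 := by
  set B := A.erase a with hB
  have hA : A = insert a B := (Finset.insert_erase ha).symm
  have haB : a ∉ B := Finset.notMem_erase a A
  set R := ∏ q ∈ Finset.univ.erase (e a), gaussianMoment (B.filter fun k => e k = q).card with hR
  set N := (B.filter fun k => e k = e a).card with hN
  have h1 : ∏ q, gaussianMoment (A.filter fun k => e k = q).card = gaussianMoment (N + 1) * R := by
    rw [← Finset.mul_prod_erase _ _ (Finset.mem_univ (e a))]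
    congr 1
    · rw [hA, Finset.filter_insert, if_pos rfl, Finset.card_insert_of_notMem (by simp [haB])]
    · refine Finset.prod_congr rfl fun q hq => ?_
      rw [hA, Finset.filter_insert, if_neg (Finset.ne_of_mem_erase hq).symm]
  have h2 : ∀ l ∈ B.filter (fun l => e l = e a),
      ∏ q, gaussianMoment ((B.erase l).filter fun k => e k = q).card =
        gaussianMoment (N - 1) * R := by
    intro l hl
    have hle := (Finset.mem_filter.1 hl).2
    rw [← Finset.mul_prod_erase _ _ (Finset.mem_univ (e a))]
    congr 1
    · rw [Finset.filter_erase, Finset.card_erase_of_mem hl]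
    · refine Finset.prod_congr rfl fun q hq => ?_
      rw [Finset.filter_erase, Finset.erase_eq_of_notMem]
      intro hlq
      exact Finset.ne_of_mem_erase hq ((Finset.mem_filter.1 hlq).2.symm.trans hle)
  rw [h1, ← Finset.sum_filter, Finset.sum_congr rfl h2, Finset.sum_const, ← hN, nsmul_eq_mul]
  -- Each of the `N` partners of `a` leaves the same product, so the claim is the recursion for
  -- moments. For `N = 0` the truncated `N - 1` is harmless, being multiplied by zero.
  rcases N with _ | N
  · simp [gaussianMoment_one]
  · rw [gaussianMoment_add_two]
    push_cast
    simp [mul_assoc]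

/-! ### Counting walks with prescribed identifications of positions. -/

section gluing

/-- The position `t` is not identified by `r` with an earlier position. -/
def IsFirst {m : ℕ} (r : Setoid (Fin m)) (t : Fin m) : Prop := ∀ s < t, ¬ r s t

lemma isFirst_castSucc_iff {m : ℕ} {r : Setoid (Fin (m + 1))} {t : Fin m} :
    IsFirst r t.castSucc ↔ IsFirst (r.comap Fin.castSucc) t := by
  constructor
  · intro h s hs
    exact h s.castSucc (Fin.castSucc_lt_castSucc_iff.2 hs)
  · intro h s hs
    induction s using Fin.lastCases with
    | last => exact absurd hs (not_lt.2 (Fin.le_last _))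
    | cast s => exact h s (Fin.castSucc_lt_castSucc_iff.1 hs)

open scoped Classical in
/-- The weight of a walk that respects the identifications of positions prescribed by `r`:
only the steps that lead to a position not identified with an earlier one count. -/
noncomputable def gluedWeight {ι : Type*} {m : ℕ} (w : ι → ι → ℝ) (r : Setoid (Fin (m + 1)))
    (u : Fin (m + 1) → ι) : ℝ :=
  if r ≤ Setoid.ker u then
    ∏ t : Fin m, if IsFirst r t.succ then w (u t.castSucc) (u t.succ) else 1
  else 0

lemma gluedWeight_nonneg {ι : Type*} {m : ℕ} {w : ι → ι → ℝ} (hw : ∀ i j, 0 ≤ w i j)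
    (r : Setoid (Fin (m + 1))) (u : Fin (m + 1) → ι) : 0 ≤ gluedWeight w r u := by
  classical
  rw [gluedWeight]
  split_ifs
  · refine Finset.prod_nonneg fun t _ => ?_
    split_ifs
    · exact hw _ _
    · exact zero_le_one
  · exact le_rfl

lemma gluedWeight_of_fin_one {ι : Type*} (w : ι → ι → ℝ) (r : Setoid (Fin 1))
    (u : Fin 1 → ι) : gluedWeight w r u = 1 := by
  classical
  rw [gluedWeight, if_pos]
  · simp
  · intro a b _
    exact congrArg u (Fin.ext (by omega))

open scoped Classical in
lemma prod_isFirst_succ {m : ℕ} (r : Setoid (Fin (m + 2))) (D : ℝ) :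
    (∏ t : Fin (m + 1), if IsFirst r t.succ then D else 1) =
      (∏ t : Fin m, if IsFirst (r.comap Fin.castSucc) t.succ then D else 1) *
        if IsFirst r (Fin.last (m + 1)) then D else 1 := by
  rw [Fin.prod_univ_castSucc, Fin.succ_last]
  congr 1
  refine Finset.prod_congr rfl fun t _ => ?_
  rw [Fin.succ_castSucc]
  exact if_congr isFirst_castSucc_iff rfl rfl

open scoped Classical in
-- A last position that is new ranges freely and yields a row sum; one identified with an earlier
-- position has its value forced and carries no weight.
lemma sum_gluedWeight_snoc {ι : Type*} [Fintype ι] {m : ℕ} (w : ι → ι → ℝ)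
    (r : Setoid (Fin (m + 2))) (u : Fin (m + 1) → ι) :
    ∑ x, gluedWeight w r (Fin.snoc u x) =
      gluedWeight w (r.comap Fin.castSucc) u *
        (if IsFirst r (Fin.last (m + 1)) then ∑ x, w (u (Fin.last m)) x
          else 1) := by
  have hker : ∀ x, r ≤ Setoid.ker (Fin.snoc u x : Fin (m + 2) → ι) ↔
      r.comap Fin.castSucc ≤ Setoid.ker u ∧
        ∀ s : Fin (m + 1), r s.castSucc (Fin.last (m + 1)) → u s = x := by
    intro x
    constructor
    · intro h
      refine ⟨fun a b hab => ?_, fun s hs => ?_⟩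
      · have := h hab
        simpa [Setoid.ker, Function.onFun] using this
      · have := h hs
        simpa [Setoid.ker, Function.onFun] using this
    · rintro ⟨h1, h2⟩ a b hab
      change (Fin.snoc u x : Fin (m + 2) → ι) a = (Fin.snoc u x : Fin (m + 2) → ι) b
      induction a using Fin.lastCases with
      | last =>
        induction b using Fin.lastCases with
        | last => rfl
        | cast b => simpa using (h2 b (r.symm hab)).symm
      | cast a =>
        induction b using Fin.lastCases with
        | last => simpa using h2 a hab
        | cast b => simpa using! h1 hab
  have hprod : ∀ x, (∏ t : Fin (m + 1), if IsFirst r t.succ then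
      w ((Fin.snoc u x : Fin (m + 2) → ι) t.castSucc) ((Fin.snoc u x : Fin (m + 2) → ι) t.succ)
        else 1) =
      (∏ t : Fin m, if IsFirst (r.comap Fin.castSucc) t.succ then
        w (u t.castSucc) (u t.succ) else 1) *
        (if IsFirst r (Fin.last (m + 1)) then w (u (Fin.last m)) x
          else 1) := by
    intro x
    rw [Fin.prod_univ_castSucc]
    congr 1
    · refine Finset.prod_congr rfl fun t _ => ?_
      rw [Fin.succ_castSucc, Fin.snoc_castSucc, Fin.snoc_castSucc]
      exact if_congr isFirst_castSucc_iff rfl rfl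
    · rw [Fin.succ_last, Fin.snoc_castSucc, Fin.snoc_last]
  simp only [gluedWeight, hker, hprod]
  by_cases hr : r.comap Fin.castSucc ≤ Setoid.ker u
  · simp only [hr, true_and, if_true]
    by_cases hnew : IsFirst r (Fin.last (m + 1))
    · have : ∀ s : Fin (m + 1), ¬ r s.castSucc (Fin.last (m + 1)) :=
        fun s => hnew _ (Fin.castSucc_lt_last s)
      simp only [if_pos hnew, this, IsEmpty.forall_iff, implies_true, if_true]
      rw [Finset.mul_sum]
    · simp only [if_neg hnew, mul_one]
      simp only [IsFirst, not_forall, not_not] at hnew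
      obtain ⟨s, hs, hrs⟩ := hnew
      induction s using Fin.lastCases with
      | last => exact absurd hs (lt_irrefl _)
      | cast s =>
        -- All earlier positions identified with the last one already agree under `u`, so exactly
        -- one `x` survives.
        have : ∀ x, (∀ s : Fin (m + 1), r s.castSucc (Fin.last (m + 1)) → u s = x) ↔
            u s = x := by
          intro x
          refine ⟨fun h => h s hrs, fun h s' hs' => ?_⟩
          rw [← h]
          exact hr (r.trans hs' (r.symm hrs))
        simp [this]
  · simp [hr]

open scoped Classical in
/-- Summing over the positions of the walk one by one, last position first: each position that is
not identified with an earlier one contributes a row sum of `w`. -/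
lemma sum_gluedWeight_le {ι : Type*} [Fintype ι] {m : ℕ} {w : ι → ι → ℝ}
    (hw : ∀ i j, 0 ≤ w i j) {D : ℝ} (hD0 : 0 ≤ D) (hD : ∀ i, ∑ j, w i j ≤ D)
    (r : Setoid (Fin (m + 1))) :
    ∑ u, gluedWeight w r u ≤
      Fintype.card ι * ∏ t : Fin m, if IsFirst r t.succ then D else 1 := by
  induction m with
  | zero => simp [gluedWeight_of_fin_one]
  | succ m ih =>
    rw [sum_fin_succ_eq_sum_snoc, prod_isFirst_succ, ← mul_assoc]
    simp only [sum_gluedWeight_snoc]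
    calc _ ≤ ∑ u, gluedWeight w (r.comap Fin.castSucc) u *
          (if IsFirst r (Fin.last (m + 1)) then D else 1) := by
          refine Finset.sum_le_sum fun u _ =>
            mul_le_mul_of_nonneg_left ?_ (gluedWeight_nonneg hw _ _)
          split_ifs
          · exact hD _
          · exact le_rfl
      _ ≤ _ := by
          rw [← Finset.sum_mul]
          refine mul_le_mul_of_nonneg_right (ih _) ?_
          split_ifs
          · exact hD0
          · exact zero_le_one

open scoped Classical in
lemma sum_gluedWeight_eq {ι : Type*} [Fintype ι] {m : ℕ} {w : ι → ι → ℝ} {D : ℝ}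
    (hD : ∀ i, ∑ j, w i j = D) (r : Setoid (Fin (m + 1))) :
    ∑ u, gluedWeight w r u =
      Fintype.card ι * ∏ t : Fin m, if IsFirst r t.succ then D else 1 := by
  induction m with
  | zero => simp [gluedWeight_of_fin_one]
  | succ m ih =>
    rw [sum_fin_succ_eq_sum_snoc, prod_isFirst_succ, ← mul_assoc, ← ih, Finset.sum_mul]
    simp only [sum_gluedWeight_snoc, hD]

end gluing

/-! ### Identifications of positions induced by oriented pairs of steps. -/

section pairing

/-- `s` closes the walk with positions `0, …, m` up and identifies, for each entry `(k, l, ε)` of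
`P`, the steps `k` and `l` of the walk, with the same orientation if `ε` and with opposite
orientations otherwise. -/
def IsGluing {m : ℕ} (P : List (Fin m × Fin m × Bool)) (s : Setoid (Fin (m + 1))) : Prop :=
  s 0 (Fin.last m) ∧ ∀ c ∈ P, if c.2.2 then
    s c.1.castSucc c.2.1.castSucc ∧ s c.1.succ c.2.1.succ
    else s c.1.castSucc c.2.1.succ ∧ s c.1.succ c.2.1.castSucc

/-- The finest identification of positions given by the pairs of steps in `P`. -/
def gluing {m : ℕ} (P : List (Fin m × Fin m × Bool)) : Setoid (Fin (m + 1)) :=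
  sInf {s | IsGluing P s}

variable {ι : Type*} {m : ℕ} {P : List (Fin m × Fin m × Bool)}

lemma IsGluing.mono {r s : Setoid (Fin (m + 1))} (hrs : r ≤ s) (h : IsGluing P r) :
    IsGluing P s := by
  refine ⟨hrs h.1, fun c hc => ?_⟩
  have := h.2 c hc
  split_ifs at this ⊢
  · exact ⟨hrs this.1, hrs this.2⟩
  · exact ⟨hrs this.1, hrs this.2⟩

/-- The conditions only require certain positions to be related, so they pass to intersections. -/
lemma isGluing_gluing (P : List (Fin m × Fin m × Bool)) : IsGluing P (gluing P) := by
  refine ⟨fun s hs => hs.1, fun c hc => ?_⟩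
  split_ifs with hε
  · refine ⟨fun s hs => ?_, fun s hs => ?_⟩
    · have := hs.2 c hc
      rw [if_pos hε] at this
      exact this.1
    · have := hs.2 c hc
      rw [if_pos hε] at this
      exact this.2
  · refine ⟨fun s hs => ?_, fun s hs => ?_⟩
    · have := hs.2 c hc
      rw [if_neg hε] at this
      exact this.1
    · have := hs.2 c hc
      rw [if_neg hε] at this
      exact this.2

lemma gluing_le_iff {s : Setoid (Fin (m + 1))} : gluing P ≤ s ↔ IsGluing P s :=
  ⟨fun h => (isGluing_gluing P).mono h, fun h => sInf_le h⟩

lemma isGluing_cons_iff {c : Fin m × Fin m × Bool} {s : Setoid (Fin (m + 1))} :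
    IsGluing (c :: P) s ↔ (if c.2.2 then
      s c.1.castSucc c.2.1.castSucc ∧ s c.1.succ c.2.1.succ
      else s c.1.castSucc c.2.1.succ ∧ s c.1.succ c.2.1.castSucc) ∧ IsGluing P s := by
  simp only [IsGluing, List.forall_mem_cons]
  tauto

open scoped Classical in
/-- Distinct first visits of the walk use distinct pairs of steps, so the weight of the pairs is
at most the weight of the steps that lead to a first visit. -/
lemma prod_pairs_le_gluedWeight {w : ι → ι → ℝ} (hw0 : ∀ i j, 0 ≤ w i j)
    (hw1 : ∀ i j, w i j ≤ 1) (hws : ∀ i j, w i j = w j i)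
    (hP : ∀ k, ∃ c ∈ P, c.1 = k ∨ c.2.1 = k) (u : Fin (m + 1) → ι) :
    (if IsGluing P (Setoid.ker u) then
      (P.map fun c => w (u c.1.castSucc) (u c.1.succ)).prod else 0) ≤
      gluedWeight w (gluing P) u := by
  rw [gluedWeight]
  simp only [gluing_le_iff]
  split_ifs with hu
  swap
  · exact le_rfl
  have hj : ∀ k : Fin m, ∃ j : Fin P.length, (P.get j).1 = k ∨ (P.get j).2.1 = k := by
    intro k
    obtain ⟨c, hc, h⟩ := hP k
    obtain ⟨j, rfl⟩ := List.get_of_mem hc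
    exact ⟨j, h⟩
  choose j hj using hj
  -- Paired steps traverse the same undirected edge, and `w` is symmetric.
  have hwj : ∀ k : Fin m, w (u (P.get (j k)).1.castSucc) (u (P.get (j k)).1.succ) =
      w (u k.castSucc) (u k.succ) := by
    intro k
    have h := hu.2 _ (P.get_mem (j k))
    rcases hj k with hk | hk
    · rw [hk]
    · rw [hk] at h
      split_ifs at h
      · have h1 : u _ = u _ := h.1
        have h2 : u _ = u _ := h.2
        rw [h1, h2]
      · have h1 : u _ = u _ := h.1
        have h2 : u _ = u _ := h.2
        rw [h1, h2, hws]
  -- If `t < t'` shared a pair, the end of `t'` would be identified with an endpoint of `t`, which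
  -- is an earlier position.
  have hlt : ∀ t t' : Fin m, IsFirst (gluing P) t'.succ → j t = j t' → ¬ t < t' := by
    intro t t' ht' hjt htt'
    have h := (isGluing_gluing P).2 _ (P.get_mem (j t))
    have key : ((gluing P) t.castSucc t'.castSucc ∧ (gluing P) t.succ t'.succ) ∨
        ((gluing P) t.castSucc t'.succ ∧ (gluing P) t.succ t'.castSucc) := by
      have hjt' := hj t'
      rw [← hjt] at hjt'
      rcases hj t with h1 | h1 <;> rcases hjt' with h2 | h2
      · exact absurd (h1.symm.trans h2) htt'.ne
      · rw [h1, h2] at h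
        split_ifs at h
        · exact Or.inl h
        · exact Or.inr h
      · rw [h1, h2] at h
        split_ifs at h
        · exact Or.inl ⟨Setoid.symm' _ h.1, Setoid.symm' _ h.2⟩
        · exact Or.inr ⟨Setoid.symm' _ h.2, Setoid.symm' _ h.1⟩
      · exact absurd (h1.symm.trans h2) htt'.ne
    rcases key with h | h
    · exact ht' _ (Fin.succ_lt_succ_iff.2 htt') h.2
    · exact ht' _ (Fin.castSucc_lt_succ_iff.2 htt'.le) h.1
  have hinj : Set.InjOn j (Finset.univ.filter fun t : Fin m => IsFirst (gluing P) t.succ) := by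
    intro t ht t' ht' hjt
    simp only [Finset.coe_filter, Finset.mem_univ, true_and, Set.mem_ofPred_eq] at ht ht'
    exact le_antisymm (not_lt.1 (hlt t' t ht hjt.symm)) (not_lt.1 (hlt t t' ht' hjt))
  have hlist : (P.map fun c => w (u c.1.castSucc) (u c.1.succ)).prod =
      ∏ i : Fin P.length, w (u (P.get i).1.castSucc) (u (P.get i).1.succ) := by
    rw [← List.prod_ofFn]
    congr 1
    conv_lhs => rw [← List.ofFn_get P, List.map_ofFn]
    rfl
  rw [hlist, ← Finset.prod_filter, Finset.prod_congr rfl fun k _ => (hwj k).symm,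
    ← Finset.prod_image (f := fun i => w (u (P.get i).1.castSucc) (u (P.get i).1.succ)) hinj]
  -- The pairs not selected by a first visit have weights in `[0, 1]` and are dropped.
  exact Finset.prod_le_prod_of_subset_of_le_one (Finset.subset_univ _) (fun _ _ => hw0 _ _)
    fun _ _ _ => hw1 _ _

end pairing

/-! ### Wick expansion of the trace moments and comparison pairing by pairing. -/

/-- The standard deviation of the `(i, j)` entry of the Gaussian matrix with variance profile
`b i j ^ 2`. -/
noncomputable def entryScale {n : ℕ} (b : Fin n → Fin n → ℝ) (i j : Fin n) : ℝ :=
  (if i = j then √2 else 1) * b i j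

/-- The expected product of the entries of a Gaussian matrix along the steps in `A` of the
walk `u`. -/
noncomputable def walkMoment {n m : ℕ} (b : Fin n → Fin n → ℝ) (u : Fin (m + 1) → Fin n)
    (A : Finset (Fin m)) : ℝ :=
  (∏ k ∈ A, entryScale b (u k.castSucc) (u k.succ)) *
    ∏ q, gaussianMoment (A.filter fun k => lowerIdx (u k.castSucc) (u k.succ) = q).card

lemma walkMoment_empty {n m : ℕ} (b : Fin n → Fin n → ℝ) (u : Fin (m + 1) → Fin n) :
    walkMoment b u ∅ = 1 := by
  simp [walkMoment, gaussianMoment_zero]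

/-- The covariance of two Gaussian entries, split into the two orientations. On the diagonal both
indicators are 1, which is what the factor `√2` there accounts for. -/
lemma entryScale_mul_entryScale {n : ℕ} {b : Fin n → Fin n → ℝ} (hb : ∀ i j, b i j = b j i)
    (i j k l : Fin n) :
    entryScale b i j * entryScale b k l * (if lowerIdx k l = lowerIdx i j then 1 else 0) =
      b i j ^ 2 * ((if i = k ∧ j = l then 1 else 0) + if i = l ∧ j = k then 1 else 0) := by
  have h2 : √2 * √2 = 2 := Real.mul_self_sqrt (by norm_num)
  by_cases hij : i = j
  · subst hij
    by_cases h : i = k ∧ i = l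
    · obtain ⟨rfl, rfl⟩ := h
      simp only [entryScale, if_true, and_self, mul_one]
      linear_combination b i i ^ 2 * h2
    · have h' : ¬ (i = l ∧ i = k) := fun h' => h h'.symm
      have h3 : ¬ lowerIdx k l = lowerIdx i i := by
        rw [lowerIdx_eq_iff]
        rintro (h3 | h3) <;> exact h ⟨h3.1.symm, h3.2.symm⟩
      simp [h, h', h3]
  · by_cases h : i = k ∧ j = l
    · obtain ⟨rfl, rfl⟩ := h
      simp [entryScale, hij, sq]
    · by_cases h' : i = l ∧ j = k
      · obtain ⟨rfl, rfl⟩ := h'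
        have h3 : lowerIdx j i = lowerIdx i j := lowerIdx_eq_iff.2 (Or.inr ⟨rfl, rfl⟩)
        simp [entryScale, hij, Ne.symm hij, h3, hb j i, sq]
      · have h3 : ¬ lowerIdx k l = lowerIdx i j := by
          rw [lowerIdx_eq_iff]
          rintro (h3 | h3)
          · exact h ⟨h3.1.symm, h3.2.symm⟩
          · exact h' ⟨h3.2.symm, h3.1.symm⟩
        simp [h, h', h3]

lemma walkMoment_eq_sum {n m : ℕ} {b : Fin n → Fin n → ℝ} (hb : ∀ i j, b i j = b j i)
    (u : Fin (m + 1) → Fin n) {A : Finset (Fin m)} {a : Fin m} (ha : a ∈ A) :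
    walkMoment b u A = ∑ l ∈ A.erase a, b (u a.castSucc) (u a.succ) ^ 2 *
      ((if u a.castSucc = u l.castSucc ∧ u a.succ = u l.succ then 1 else 0) +
        if u a.castSucc = u l.succ ∧ u a.succ = u l.castSucc then 1 else 0) *
      walkMoment b u ((A.erase a).erase l) := by
  rw [walkMoment, prod_gaussianMoment_eq_sum _ A ha, Finset.mul_sum]
  refine Finset.sum_congr rfl fun l hl => ?_
  rw [← entryScale_mul_entryScale hb, ← Finset.mul_prod_erase _ _ ha,
    ← Finset.mul_prod_erase _ _ hl, walkMoment]
  split_ifs <;> ring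

section pairingSum

open scoped Classical in
/-- The part of the Wick expansion of the expected trace of a power of a Gaussian matrix in which
the pairs in `P` have been formed and the steps in `A` are still to be paired. -/
noncomputable def pairingSum {n m : ℕ} (b : Fin n → Fin n → ℝ)
    (P : List (Fin m × Fin m × Bool)) (A : Finset (Fin m)) : ℝ :=
  ∑ u : Fin (m + 1) → Fin n, if IsGluing P (Setoid.ker u) then
    (P.map fun c => b (u c.1.castSucc) (u c.1.succ) ^ 2).prod * walkMoment b u A else 0

lemma pairingSum_eq_sum {n m : ℕ} {b : Fin n → Fin n → ℝ} (hb : ∀ i j, b i j = b j i)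
    (P : List (Fin m × Fin m × Bool)) {A : Finset (Fin m)} {a : Fin m} (ha : a ∈ A) :
    pairingSum b P A =
      ∑ l ∈ A.erase a, ∑ ε, pairingSum b ((a, l, ε) :: P) ((A.erase a).erase l) := by
  classical
  simp only [pairingSum]
  simp_rw [Finset.sum_comm (s := (Finset.univ : Finset Bool))]
  rw [Finset.sum_comm]
  refine Finset.sum_congr rfl fun u _ => ?_
  by_cases h : IsGluing P (Setoid.ker u)
  · rw [if_pos h, walkMoment_eq_sum hb u ha, Finset.mul_sum]
    refine Finset.sum_congr rfl fun l _ => ?_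
    simp only [isGluing_cons_iff, h, and_true, Fintype.sum_bool, if_true, Bool.false_eq_true,
      if_false, List.map_cons, List.prod_cons, Setoid.ker_def]
    split_ifs <;> ring
  · simp [isGluing_cons_iff, h]

/-- Comparison of the contributions of a complete pairing. -/
lemma pairingSum_empty_le {n d m : ℕ} {b : Fin n → Fin n → ℝ} (hb : ∀ i j, b i j = b j i)
    (hb1 : ∀ i j, b i j ^ 2 ≤ 1) (hbd : ∀ i, ∑ j, b i j ^ 2 ≤ d)
    {P : List (Fin m × Fin m × Bool)} (hP : ∀ k, ∃ c ∈ P, c.1 = k ∨ c.2.1 = k) :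
    d * pairingSum b P ∅ ≤ n * pairingSum (fun _ _ : Fin d => 1) P ∅ := by
  classical
  have h1 : pairingSum b P ∅ ≤ n * ∏ t : Fin m, if IsFirst (gluing P) t.succ then (d : ℝ) else 1 := by
    calc pairingSum b P ∅ ≤ ∑ u, gluedWeight (fun i j => b i j ^ 2) (gluing P) u := by
          refine Finset.sum_le_sum fun u _ => ?_
          rw [walkMoment_empty, mul_one]
          exact prod_pairs_le_gluedWeight (w := fun i j => b i j ^ 2) (fun _ _ => sq_nonneg _)
            hb1 (fun i j => by rw [hb]) hP u
      _ ≤ _ := by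
          simpa using sum_gluedWeight_le (w := fun i j => b i j ^ 2) (fun _ _ => sq_nonneg _)
            (Nat.cast_nonneg d) hbd (gluing P)
  -- With unit weights the sum just counts the walks compatible with the gluing.
  have h2 : pairingSum (fun _ _ : Fin d => 1) P ∅ =
      d * ∏ t : Fin m, if IsFirst (gluing P) t.succ then (d : ℝ) else 1 := by
    have h := sum_gluedWeight_eq (w := fun _ _ : Fin d => 1) (D := d) (by simp) (gluing P)
    rw [Fintype.card_fin] at h
    rw [← h]
    refine Finset.sum_congr rfl fun u _ => ?_
    simp [gluedWeight, gluing_le_iff, walkMoment_empty]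
  rw [h2]
  calc _ ≤ (d : ℝ) * (n * ∏ t : Fin m, if IsFirst (gluing P) t.succ then (d : ℝ) else 1) :=
        mul_le_mul_of_nonneg_left h1 (Nat.cast_nonneg d)
    _ = _ := by ring

/-- This is the comparison of normalized traces with denominators cleared. Expanding both sides at
the same step `a` matches the terms by partner and orientation; `hP` records that every step already
removed from `A` is covered by `P`. -/
lemma pairingSum_le {n d m : ℕ} {b : Fin n → Fin n → ℝ} (hb : ∀ i j, b i j = b j i)
    (hb1 : ∀ i j, b i j ^ 2 ≤ 1) (hbd : ∀ i, ∑ j, b i j ^ 2 ≤ d) (A : Finset (Fin m))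
    (P : List (Fin m × Fin m × Bool)) (hP : ∀ k ∉ A, ∃ c ∈ P, c.1 = k ∨ c.2.1 = k) :
    d * pairingSum b P A ≤ n * pairingSum (fun _ _ : Fin d => 1) P A := by
  induction A using Finset.strongInduction generalizing P with
  | H A ih =>
    rcases A.eq_empty_or_nonempty with rfl | ⟨a, ha⟩
    · exact pairingSum_empty_le hb hb1 hbd fun k => hP k (Finset.notMem_empty k)
    · rw [pairingSum_eq_sum hb P ha, pairingSum_eq_sum (fun _ _ => rfl) P ha, Finset.mul_sum,
        Finset.mul_sum]
      refine Finset.sum_le_sum fun l _ => ?_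
      rw [Finset.mul_sum, Finset.mul_sum]
      refine Finset.sum_le_sum fun ε _ => ih _ ?_ _ fun k hk => ?_
      · exact (Finset.erase_subset _ _).trans_ssubset (Finset.erase_ssubset ha)
      · by_cases hkl : k = l
        · exact ⟨_, List.mem_cons_self, Or.inr hkl.symm⟩
        by_cases hka : k = a
        · exact ⟨_, List.mem_cons_self, Or.inl hka.symm⟩
        obtain ⟨c, hc, h⟩ := hP k fun hkA =>
          hk (Finset.mem_erase.2 ⟨hkl, Finset.mem_erase.2 ⟨hka, hkA⟩⟩)
        exact ⟨c, List.mem_cons_of_mem _ hc, h⟩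

lemma pairingSum_nil_univ {n m : ℕ} (b : Fin n → Fin n → ℝ) :
    pairingSum b ([] : List (Fin m × Fin m × Bool)) Finset.univ =
      ∑ u : Fin (m + 1) → Fin n, if u 0 = u (Fin.last m) then
        (∏ k : Fin m, entryScale b (u k.castSucc) (u k.succ)) *
          ∏ q, gaussianMoment (Finset.univ.filter
            fun k : Fin m => lowerIdx (u k.castSucc) (u k.succ) = q).card else 0 := by
  classical
  refine Finset.sum_congr rfl fun u _ => ?_
  simp [IsGluing, walkMoment, Setoid.ker_def]

end pairingSum

/-! ### The symmetric model: domination by Gaussian moments. -/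

lemma integral_pow_eq_zero_of_odd {Ω : Type*} [MeasurableSpace Ω] {μ : Measure Ω} {f : Ω → ℝ}
    (hf : IdentDistrib f (fun ω => -f ω) μ μ) {k : ℕ} (hk : Odd k) : ∫ ω, f ω ^ k ∂μ = 0 := by
  have h := (hf.comp (u := fun x : ℝ => x ^ k) (by fun_prop)).integral_eq
  simp only [Function.comp_def, hk.neg_pow, integral_neg] at h
  linarith

namespace IsSymmModel

variable {Ω : Type*} [MeasurableSpace Ω] {μ : Measure Ω} {n : ℕ} {b : Fin n → Fin n → ℝ}
  {ξ : Fin n → Fin n → Ω → ℝ} {X : Ω → Matrix (Fin n) (Fin n) ℝ}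

lemma apply_eq (hX : IsSymmModel μ b ξ X) (ω : Ω) (i j : Fin n) :
    X ω i j = entryScale b i j * ξ (lowerIdx i j).1.1 (lowerIdx i j).1.2 ω := by
  have hξ : ξ (max i j) (min i j) = ξ i j := by
    rcases le_total i j with h | h
    · rw [max_eq_right h, min_eq_left h, hX.xi_symm]
    · rw [max_eq_left h, min_eq_right h]
  simp only [lowerIdx, hξ, entryScale]
  by_cases h : i = j
  · subst h
    rw [hX.diag, if_pos rfl]
  · rw [hX.offDiag i j h, if_neg h, one_mul]

lemma entryScale_nonneg (hX : IsSymmModel μ b ξ X) (i j : Fin n) : 0 ≤ entryScale b i j :=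
  mul_nonneg (by split_ifs <;> positivity) (hX.b_nonneg i j)

lemma integral_pow_nonneg (hX : IsSymmModel μ b ξ X) (i j : Fin n) (k : ℕ) :
    0 ≤ ∫ ω, ξ i j ω ^ k ∂μ := by
  rcases Nat.even_or_odd k with hk | hk
  · exact integral_nonneg fun ω => hk.pow_nonneg _
  · exact (integral_pow_eq_zero_of_odd (hX.xi_symmDistrib i j) hk).ge

lemma integral_pow_le (hX : IsSymmModel μ b ξ X) (i j : Fin n) (k : ℕ) :
    ∫ ω, ξ i j ω ^ k ∂μ ≤ gaussianMoment k := by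
  rcases Nat.even_or_odd' k with ⟨p, rfl | rfl⟩
  · exact hX.xi_moment_le i j p
  · rw [integral_pow_eq_zero_of_odd (hX.xi_symmDistrib i j) (odd_two_mul_add_one p)]
    exact gaussianMoment_nonneg _

variable [IsProbabilityMeasure μ]

lemma integrable_trace_pow (hX : IsSymmModel μ b ξ X) (m : ℕ) :
    Integrable (fun ω => (X ω ^ m).trace) μ :=
  _root_.integrable_trace_pow (Z := fun q => ξ q.1.1 q.1.2) (fun _ => hX.xi_aemeasurable _ _)
    (fun _ => hX.xi_integrable _ _) hX.apply_eq m

/-- The comparison is made walk by walk: the scales are nonnegative and every moment lies between 0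
and its Gaussian counterpart. -/
lemma integral_trace_pow_le (hX : IsSymmModel μ b ξ X) (m : ℕ) :
    ∫ ω, (X ω ^ m).trace ∂μ ≤
      pairingSum b ([] : List (Fin m × Fin m × Bool)) Finset.univ := by
  rw [pairingSum_nil_univ, integral_trace_pow (Z := fun q => ξ q.1.1 q.1.2)
    (fun _ => hX.xi_aemeasurable _ _) (fun _ => hX.xi_integrable _ _) hX.xi_indep hX.apply_eq m]
  refine Finset.sum_le_sum fun u _ => ?_
  split_ifs
  · exact mul_le_mul_of_nonneg_left
      (Finset.prod_le_prod (fun q _ => hX.integral_pow_nonneg _ _ _)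
        fun q _ => hX.integral_pow_le _ _ _)
      (Finset.prod_nonneg fun k _ => hX.entryScale_nonneg _ _)
  · exact le_rfl

end IsSymmModel

/-! ### The GOE as the Gaussian model with constant profile 1. -/

namespace IsGOE

variable {Ω : Type*} [MeasurableSpace Ω] {μ : Measure Ω} {d : ℕ}
  {Y : Ω → Matrix (Fin d) (Fin d) ℝ}

/-- The entries of a GOE matrix on and below the diagonal, normalized to have unit variance. -/
noncomputable def normalizedEntry (Y : Ω → Matrix (Fin d) (Fin d) ℝ) (q : LowerIdx d) (ω : Ω) :
    ℝ := Y ω q.1.1 q.1.2 / if q.1.1 = q.1.2 then √2 else 1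

lemma hasLaw_normalizedEntry (hY : IsGOE μ Y) (q : LowerIdx d) :
    HasLaw (normalizedEntry Y q) (gaussianReal 0 1) μ := by
  obtain ⟨⟨i, j⟩, hij⟩ := q
  by_cases h : i = j
  · subst h
    have h2 := gaussianReal_div_const (hY.diag_law i) √2
    have hv : (2 : NNReal) / .mk (√2 ^ 2) (sq_nonneg _) = 1 := by
      ext
      simp
    rw [zero_div, hv] at h2
    have he : normalizedEntry Y ⟨(i, i), hij⟩ = fun ω => Y ω i i / √2 := by
      ext ω
      simp [normalizedEntry]
    rwa [he]
  · have h1 := hY.offDiag_law i j (lt_of_le_of_ne hij (Ne.symm h))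
    have he : normalizedEntry Y ⟨(i, j), hij⟩ = fun ω => Y ω i j := by
      ext ω
      simp [normalizedEntry, h]
    rwa [he]

lemma iIndepFun_normalizedEntry (hY : IsGOE μ Y) : iIndepFun (normalizedEntry Y) μ :=
  hY.indep.comp (fun q x => x / if q.1.1 = q.1.2 then √2 else 1) fun _ => by fun_prop

lemma integrable_normalizedEntry_pow (hY : IsGOE μ Y) (q : LowerIdx d) (k : ℕ) :
    Integrable (fun ω => normalizedEntry Y q ω ^ k) μ := by
  have h := hY.hasLaw_normalizedEntry q
  have hi := integrable_pow_gaussianReal k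
  rw [← h.map_eq] at hi
  exact hi.comp_aemeasurable h.aemeasurable

lemma integral_normalizedEntry_pow (hY : IsGOE μ Y) (q : LowerIdx d) (k : ℕ) :
    ∫ ω, normalizedEntry Y q ω ^ k ∂μ = gaussianMoment k :=
  (hY.hasLaw_normalizedEntry q).integral_comp (f := fun x : ℝ => x ^ k) (by fun_prop)

lemma apply_eq (hY : IsGOE μ Y) (ω : Ω) (i j : Fin d) :
    Y ω i j = entryScale (fun _ _ => 1) i j * normalizedEntry Y (lowerIdx i j) ω := by
  have hs : Y ω (max i j) (min i j) = Y ω i j := by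
    rcases le_total i j with h | h
    · rw [max_eq_right h, min_eq_left h, (hY.symm ω).apply]
    · rw [max_eq_left h, min_eq_right h]
  have hne : (√2 : ℝ) ≠ 0 := by positivity
  simp only [normalizedEntry, lowerIdx, hs, entryScale, mul_one]
  by_cases h : i = j
  · subst h
    simp only [max_self, min_self, if_true]
    field_simp
  · have h' : max i j ≠ min i j := (min_lt_max.2 h).ne'
    simp [h, h']

variable [IsProbabilityMeasure μ]

lemma integrable_trace_pow (hY : IsGOE μ Y) (m : ℕ) :
    Integrable (fun ω => (Y ω ^ m).trace) μ :=
  _root_.integrable_trace_pow (fun q => (hY.hasLaw_normalizedEntry q).aemeasurable)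
    (fun _ _ => hY.integrable_normalizedEntry_pow _ _) hY.apply_eq m

lemma integral_trace_pow_eq (hY : IsGOE μ Y) (m : ℕ) :
    ∫ ω, (Y ω ^ m).trace ∂μ =
      pairingSum (fun _ _ : Fin d => 1) ([] : List (Fin m × Fin m × Bool)) Finset.univ := by
  rw [pairingSum_nil_univ, integral_trace_pow
    (fun q => (hY.hasLaw_normalizedEntry q).aemeasurable)
    (fun _ _ => hY.integrable_normalizedEntry_pow _ _) hY.iIndepFun_normalizedEntry
    hY.apply_eq m]
  simp only [hY.integral_normalizedEntry_pow]

end IsGOE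

/-! ### The extremum principle. -/

/-- Extremum principle for real symmetric matrices with independent entries. Integrability of both
sides is part of the conclusion, so that both expectations are genuine. -/
theorem theorem3p1
    {Ω : Type*} [MeasurableSpace Ω] (μ : Measure Ω) [IsProbabilityMeasure μ]
    {Ω' : Type*} [MeasurableSpace Ω'] (ν : Measure Ω') [IsProbabilityMeasure ν]
    (n d : ℕ) (b : Fin n → Fin n → ℝ) (ξ : Fin n → Fin n → Ω → ℝ)
    (X : Ω → Matrix (Fin n) (Fin n) ℝ) (hX : IsSymmModel μ b ξ X)
    (hstar : sigmaStarSq b = 1) (hsigma : sigmaSq b ≤ (d : ℝ))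
    (Y : Ω' → Matrix (Fin d) (Fin d) ℝ) (hY : IsGOE ν Y) (p : ℕ) :
    Integrable (fun ω => normTrace (X ω ^ (2 * p))) μ ∧
    Integrable (fun ω => normTrace (Y ω ^ (2 * p))) ν ∧
    ∫ ω, normTrace (X ω ^ (2 * p)) ∂μ ≤ ∫ ω, normTrace (Y ω ^ (2 * p)) ∂ν := by

  have hle : ∀ i j, b i j ^ 2 ≤ 1 := fun i j =>
    hstar ▸ le_ciSup (f := fun q : Fin n × Fin n => b q.1 q.2 ^ 2)
      (Set.finite_range _).bddAbove (i, j)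
  have hrow : ∀ i, ∑ j, b i j ^ 2 ≤ (d : ℝ) := fun i =>
    (le_ciSup (f := fun i => ∑ j, b i j ^ 2) (Set.finite_range _).bddAbove i).trans hsigma
  -- A real supremum over an empty index set is 0, so `hstar` excludes `n = 0`.
  have hn : Nonempty (Fin n × Fin n) := by
    by_contra h
    rw [not_nonempty_iff] at h
    rw [sigmaStarSq, Real.iSup_of_isEmpty] at hstar
    exact zero_ne_one hstar
  have hn0 : (0 : ℝ) < n := Nat.cast_pos.2 hn.some.1.pos
  -- The row containing an entry with `b i j ^ 2 = 1` has sum at least 1, whence `d ≥ 1`.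
  have hd0 : (0 : ℝ) < d := by
    obtain ⟨q, hq⟩ := exists_eq_ciSup_of_finite (f := fun q : Fin n × Fin n => b q.1 q.2 ^ 2)
    have h1 : b q.1 q.2 ^ 2 = 1 := hq.trans hstar
    have h2 := Finset.single_le_sum (f := fun j => b q.1 j ^ 2) (fun _ _ => sq_nonneg _)
      (Finset.mem_univ q.2)
    linarith [hrow q.1]
  simp only [normTrace]
  refine ⟨(hX.integrable_trace_pow _).const_mul _, (hY.integrable_trace_pow _).const_mul _, ?_⟩
  rw [integral_const_mul, integral_const_mul, hY.integral_trace_pow_eq]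
  have h := pairingSum_le (d := d) hX.b_symm hle hrow Finset.univ
    ([] : List (Fin (2 * p) × Fin (2 * p) × Bool)) (by simp)
  refine (mul_le_mul_of_nonneg_left (hX.integral_trace_pow_le _) (by positivity)).trans ?_
  rw [one_div, one_div, inv_mul_le_iff₀ hn0, ← mul_assoc, mul_comm (n : ℝ), mul_assoc,
    le_inv_mul_iff₀ hd0]
  exact h
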